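/- Let $F$ be a field and let $\mathcal D=F(x)[\tau]$ be the ring of recurrence operators, with multiplication $\tau\, r(x)=r(x+1)\,\tau$; put $\mathcal P=F[x][\tau]\subset\mathcal D$. For a non-zero $L=\sum_{i=0}^n a_i(x)\tau^i\in\mathcal P$ of order $n$ (so $a_n\ne 0$) write $\ell(L)=a_n(x-n)$. For $L\in\mathcal D\setminus\{0\}$ let $$\mathcal I_\infty(L)=\{0\}\cup\{\ell(AL)\;:\;A\in\mathcal D\setminus\{0\},\ AL\in\mathcal P\},$$ which is an ideal of $F[x]$, and let $\mathfrak{lc}_\infty(L)$ be its monic generator. The true singularities of $L$ are the monic irreducible factors of $\mathfrak{lc}_\infty(L)$ in $F[x]$, counted with multiplicity. Call $r_1,r_2\in F(x)\setminus\{0\}$ shift equivalent if there is $f\in F(x)\setminus\{0\}$ with $r_1/r_2=f(x+1)/f(x)$. Say that $L_1$ and $L_2$ have the same true singularities up to integer shifts if there is a bijection (respecting multiplicities) between their true singularities under which each $q(x)$ corresponds to $q(x+m)$ for some integer $m$ depending on the factor. 1. Suppose $F$ has prime characteristic $p$, and let $L_1,L_2\in\mathcal D$ be non-zero operators with $\mathcal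 D/\mathcal DL_1\cong\mathcal D/\mathcal DL_2$ as left $\mathcal D$-modules. Then $\mathfrak{lc}_\infty(L_1)$ and $\mathfrak{lc}_\infty(L_2)$ are shift equivalent, and $L_1$ and $L_2$ have the same true singularities up to integer shifts. 2. Both conclusions can fail in characteristic $0$: over every field $F$ of characteristic $0$ there are non-zero $L_1,L_2\in\mathcal D$ with $\mathcal D/\mathcal DL_1\cong\mathcal D/\mathcal DL_2$ as left $\mathcal D$-modules such that $\mathfrak{lc}_\infty(L_1)$ and $\mathfrak{lc}_\infty(L_2)$ are not shift equivalent and $L_1$ and $L_2$ do not have the same true singularities up to integer shifts. -/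

import Mathlib

open Polynomial

noncomputable section

namespace RecurrenceOperator

/-- The automorphism `r(x) ↦ r(x + 1)` of the field `F(x)` (as a ring homomorphism). -/
def shift (F : Type*) [Field F] : RatFunc F →+* RatFunc F :=
  RatFunc.mapRingHom (taylorEquiv (1 : F))
    (nonZeroDivisors_le_comap_nonZeroDivisors_of_injective _ (taylorEquiv (1 : F)).injective)

/-- The natural number `n` acts on `F(x)` by `r(x) ↦ r(x + n)`. This fixes the multiplication
`τ * r(x) = r(x + 1) * τ` in the skew polynomial ring over `F(x)`. -/
instance instShiftAction (F : Type*) [Field F] :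
    MulSemiringAction (Multiplicative ℕ) (RatFunc F) :=
  MulSemiringAction.compHom (RatFunc F) (powersHom (RatFunc F →+* RatFunc F) (shift F))

/-- The ring `𝓓 = F(x)[τ]` of recurrence operators; `τ` is `SkewPolynomial.X`. -/
abbrev Op (F : Type*) [Field F] := SkewPolynomial (RatFunc F)

variable {F : Type*} [Field F]

/-- The order of an operator: the largest `n` such that `τ ^ n` has a nonzero coefficient
(and `0` for the zero operator). -/
def ord (L : Op F) : ℕ := L.support.sup id

/-- `L` lies in the subring `𝓟 = F[x][τ]`. -/
def IsPolynomial (L : Op F) : Prop :=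
  ∀ i, ∃ q : F[X], L.coeff i = algebraMap F[X] (RatFunc F) q

/-- The ideal `𝓘_∞` of `F[x]` attached to `L`: it consists of `0` and of the polynomials
`a_n(x - n)`, where `a_n` is the leading coefficient and `n` is the order of a nonzero left multiple
`A L` with polynomial coefficients. (These polynomials are taken here without making them monic, and
together with `0` they already form an ideal.) -/
def lcIdeal (L : Op F) : Ideal F[X] :=
  Ideal.span {q | ∃ A : Op F, A ≠ 0 ∧ IsPolynomial (A * L) ∧
    ∃ a : F[X], (A * L).coeff (ord (A * L)) = algebraMap F[X] (RatFunc F) a ∧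
      q = a.comp (X - C (ord (A * L) : F))}

open Classical in
/-- `𝔩𝔠_∞(L)`: the monic generator of the ideal `𝓘_∞` of `L`. -/
def lcInf (L : Op F) : F[X] :=
  normalize (Submodule.IsPrincipal.generator (lcIdeal L))

open Classical in
/-- The true singularities of `L`: the monic irreducible factors of `𝔩𝔠_∞(L)` in `F[x]`,
with their multiplicities. -/
def trueSingularities (L : Op F) : Multiset F[X] :=
  UniqueFactorizationMonoid.normalizedFactors (lcInf L)

/-- Shift equivalence of `r₁, r₂ ∈ F(x) - {0}`: there is `f ≠ 0` in `F(x)` with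
`r₁ / r₂ = f(x + 1) / f(x)`. (By the convention `r / 0 = 0` it never holds
when `r₁` or `r₂` is zero.) -/
def ShiftEquivalent (r₁ r₂ : RatFunc F) : Prop :=
  ∃ f : RatFunc F, f ≠ 0 ∧ r₁ / r₂ = shift F f / f

/-- `L₁` and `L₂` have the same true singularities up to integer shifts: there is a
multiplicity-preserving matching of the true singularities of `L₁` with those of `L₂` in which each
`q₁(x)` is matched with some `q₁(x + n)`, where the integer `n` may depend on the factor. -/
def SameTrueSingularitiesUpToShifts (L₁ L₂ : Op F) : Prop :=
  Multiset.Rel (fun q₁ q₂ : F[X] => ∃ n : ℤ, q₂ = q₁.comp (X + C (n : F)))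
    (trueSingularities L₁) (trueSingularities L₂)

/-- The left `𝓓`-module `𝓓 / 𝓓 L`. -/
abbrev QuotientModule (L : Op F) : Type _ := Op F ⧸ Submodule.span (Op F) {L}

end RecurrenceOperator

end

/-! Let `m` be a cyclic vector of a `𝓓`-module `M` with annihilator `𝓓 L`, and let `Λ_n` be the
`F[x]`-span of `m, τ m, …, τ ^ (n - 1) m` (`krylov`). The polynomials `r` with `r(x + n) τ ^ n m ∈
Λ_n` form an increasing chain of ideals whose union is `𝓘_∞(L)` (`lcIdeal_eq_iSup`). The chain
stabilizes, so for large `n` the quotient `Λ_{n+1} / Λ_n` is `F[x] / (g(x + n))`, where `g`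
generates `𝓘_∞(L)`. Hence `g` governs how fast the determinant of the lattice `Λ_n` changes with
`n`.

In characteristic `p`, each run of `p` steps divides the determinant, up to units, by the same
polynomial, the shift invariant norm `g(x) g(x + 1) ⋯ g(x + p - 1)` (`latticeDet_krylov_add_mul`).
An isomorphism of quotient modules puts two cyclic vectors `m`, `m'` in one module. A shift
invariant common denominator `c` gives `c Λ'_n ⊆ Λ_{n+k}` for all `n`
(`exists_smul_mem_krylov_add`). Comparing determinants as `n → ∞` shows that one norm divides the
other (`shiftNorm_dvd_shiftNorm`), and by symmetry they are associated. Unique factorization then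
matches the irreducible factors up to shifts (`rel_shift_of_associated_shiftNorm`), and telescoping
products turn the matching into shift equivalence.

In characteristic `0` the pair `τ - 1` and `(τ - 1) x` is a counterexample: `x` is a unit of `𝓓`, so
the modules are isomorphic, yet `𝔩𝔠_∞` is `1` for the first operator and divisible by `x` for the
second. -/

open Polynomial

noncomputable section

namespace RecurrenceOperator


/-! ### Determinants of lattices over a principal ideal domain. -/

section LatticeDet

open Module

variable {R K V ι : Type*} [CommRing R] [Field K] [Algebra R K]
  [AddCommGroup V] [Module K V] [Module R V] [IsScalarTower R K V] [Fintype ι] [DecidableEq ι]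

/-- If the vectors `v i` are `R`-combinations of the vectors `w j`, then the determinant of `v` is an
`R`-multiple of the determinant of `w`. -/
theorem exists_det_eq_smul_of_mem_span (e : Basis ι K V) {v w : ι → V}
    (h : ∀ i, v i ∈ Submodule.span R (Set.range w)) : ∃ r : R, e.det v = r • e.det w := by
  simp only [Submodule.mem_span_range_iff_exists_fun] at h
  choose c hc using h
  refine ⟨(Matrix.of c).det, ?_⟩
  have : e.toMatrix v = e.toMatrix w * ((Matrix.of c).map (algebraMap R K)).transpose := by
    ext i j
    simp only [Basis.toMatrix_apply, Matrix.mul_apply, Matrix.transpose_apply, Matrix.map_apply,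
      Matrix.of_apply, ← hc j, map_sum, Finsupp.coe_finsetSum, Finset.sum_apply]
    refine Finset.sum_congr rfl fun k _ => ?_
    rw [← algebraMap_smul K (c j k) (w k), map_smul, Finsupp.smul_apply, smul_eq_mul, mul_comm]
  rw [Basis.det_apply, Basis.det_apply, this, Matrix.det_mul, Matrix.det_transpose,
    Algebra.smul_def, mul_comm, RingHom.map_det, RingHom.mapMatrix_apply]

theorem det_const_smul (e : Basis ι K V) (c : R) (v : ι → V) :
    e.det (fun i => c • v i) = c ^ Fintype.card ι • e.det v := by
  have := e.det.map_smul_univ (fun _ => algebraMap R K c) v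
  simp only [algebraMap_smul, Finset.prod_const, Finset.card_univ] at this
  rw [this, ← map_pow, algebraMap_smul]

variable [IsDomain R] [IsPrincipalIdealRing R] [IsFractionRing R K]

theorem isTorsionFree_of_isFractionRing (R K V : Type*) [CommRing R] [Field K] [Algebra R K]
    [AddCommGroup V] [Module K V] [Module R V] [IsScalarTower R K V] [IsDomain R]
    [IsFractionRing R K] : Module.IsTorsionFree R V :=
  have : FaithfulSMul R K := (faithfulSMul_iff_algebraMap_injective R K).2
    (IsFractionRing.injective R K)
  Module.IsTorsionFree.trans_faithfulSMul R K V

theorem exists_basis_isLattice {ι : Type*} (e : Basis ι K V) (Λ : Submodule R V)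
    [Submodule.IsLattice K Λ] : Nonempty (Basis ι R Λ) := by
  have : FaithfulSMul R K := (faithfulSMul_iff_algebraMap_injective R K).2
    (IsFractionRing.injective R K)
  have : Module.IsTorsionFree R K := inferInstance
  let b := Free.chooseBasis R Λ
  exact ⟨b.reindex ((b.extendOfIsLattice K).indexEquiv e)⟩

/-- The determinant, with respect to a fixed basis of the ambient space, of an `R`-basis of a lattice.
It is determined by the lattice up to units of `R`. -/
def latticeDet (e : Basis ι K V) (Λ : Submodule R V) [Submodule.IsLattice K Λ] : K :=
  e.det fun i => ((exists_basis_isLattice e Λ).some i : V)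

theorem latticeDet_ne_zero (e : Basis ι K V) (Λ : Submodule R V) [Submodule.IsLattice K Λ] :
    latticeDet e Λ ≠ 0 := by
  have := e.isUnit_det ((exists_basis_isLattice e Λ).some.extendOfIsLattice K)
  have h : ⇑((exists_basis_isLattice e Λ).some.extendOfIsLattice K) =
      fun i => ((exists_basis_isLattice e Λ).some i : V) := by
    ext i
    simp
  rw [h] at this
  exact this.ne_zero

theorem span_range_coe_basis {R V ι : Type*} [CommRing R] [AddCommGroup V] [Module R V]
    {Λ : Submodule R V} (b : Basis ι R Λ) :
    Submodule.span R (Set.range fun i => (b i : V)) = Λ := by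
  have := congrArg (Submodule.map Λ.subtype) b.span_eq
  rwa [Submodule.map_span, ← Set.range_comp, Submodule.map_top, Submodule.range_subtype] at this

/-- Turns an inclusion `c Λ ⊆ Λ'` into a divisibility; the exponent is the dimension, since `c`
scales every basis vector. -/
theorem exists_pow_smul_latticeDet_eq_smul (e : Basis ι K V) (Λ Λ' : Submodule R V)
    [Submodule.IsLattice K Λ] [Submodule.IsLattice K Λ'] (c : R) (h : ∀ v ∈ Λ, c • v ∈ Λ') :
    ∃ r : R, c ^ Fintype.card ι • latticeDet e Λ = r • latticeDet e Λ' := by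
  rw [latticeDet, ← det_const_smul]
  refine exists_det_eq_smul_of_mem_span e fun i => ?_
  rw [span_range_coe_basis]
  exact h _ (Subtype.mem _)

/-- Two families of the size of a basis that span the same lattice have associated determinants. -/
theorem exists_units_smul_latticeDet_eq (e : Basis ι K V) (Λ : Submodule R V)
    [Submodule.IsLattice K Λ] (v : ι → V) (h : Submodule.span R (Set.range v) = Λ) :
    ∃ u : Rˣ, latticeDet e Λ = u • e.det v := by
  obtain ⟨r, hr⟩ : ∃ r : R, latticeDet e Λ = r • e.det v :=
    exists_det_eq_smul_of_mem_span e fun i => by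
      rw [h]
      exact Subtype.mem _
  obtain ⟨s, hs⟩ : ∃ s : R, e.det v = s • latticeDet e Λ :=
    exists_det_eq_smul_of_mem_span e fun i => by
      rw [span_range_coe_basis, ← h]
      exact Submodule.subset_span ⟨i, rfl⟩
  have h1 : r * s = 1 := by
    apply IsFractionRing.injective R K
    apply mul_right_cancel₀ (latticeDet_ne_zero e Λ)
    rw [← Algebra.smul_def, mul_smul, ← hs, ← hr, map_one, one_mul]
  exact ⟨Units.mkOfMulEqOne r s h1, hr⟩

/-- Smith normal form of the submodule generated by `u`, whose rank is at most one. -/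
theorem exists_basis_smul_eq {ι : Type*} [Finite ι] [Nonempty ι] {N : Type*} [AddCommGroup N]
    [Module R N] (b : Basis ι R N) (u : N) : ∃ (b' : Basis ι R N) (i : ι) (h : R), u = h • b' i := by
  obtain ⟨n, s⟩ := Submodule.smithNormalForm b (Submodule.span R {u})
  have hn : n ≤ 1 := by
    have := finrank_span_le_card (R := R) ({u} : Set N)
    rw [finrank_eq_card_basis s.bN] at this
    simpa using this
  have hu := s.bN.sum_repr ⟨u, Submodule.mem_span_singleton_self u⟩
  replace hu := congrArg (Submodule.subtype _) hu
  rw [map_sum] at hu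
  rcases Nat.le_one_iff_eq_zero_or_eq_one.1 hn with rfl | rfl
  · refine ⟨b, Classical.arbitrary ι, 0, ?_⟩
    simpa using hu.symm
  · refine ⟨s.bM, s.f 0, s.bN.repr ⟨u, Submodule.mem_span_singleton_self u⟩ 0 * s.a 0, ?_⟩
    rw [mul_smul, ← s.snf]
    simpa using hu.symm

/-- The determinant of a lattice under a cyclic extension. -/
theorem exists_units_smul_latticeDet_sup_span (e : Basis ι K V) (Λ Λ' : Submodule R V)
    [Submodule.IsLattice K Λ] [Submodule.IsLattice K Λ'] (w : V) (g : R) (hg : g ≠ 0)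
    (hΛ' : Λ' = Λ ⊔ Submodule.span R {w}) (hw : ∀ r : R, r • w ∈ Λ ↔ g ∣ r) :
    ∃ u : Rˣ, latticeDet e Λ = u • g • latticeDet e Λ' := by
  have htf : Module.IsTorsionFree R V := isTorsionFree_of_isFractionRing R K V
  rcases isEmpty_or_nonempty ι with hι | hι
  -- In dimension zero `w ∈ Λ` forces `g` to be a unit, and both determinants are `1`.
  · have : Subsingleton V := e.repr.toEquiv.subsingleton
    have h1 : IsUnit g := isUnit_of_dvd_one ((hw 1).1 (by
      rw [Subsingleton.elim w 0, smul_zero]; exact Λ.zero_mem))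
    refine ⟨h1.unit⁻¹, ?_⟩
    simp only [latticeDet, Basis.det_isEmpty, AlternatingMap.constOfIsEmpty_apply]
    rw [Units.smul_def, ← mul_smul]
    simp
  obtain ⟨b, i₀, h, hb⟩ := exists_basis_smul_eq (exists_basis_isLattice e Λ).some
    ⟨g • w, (hw g).2 dvd_rfl⟩
  replace hb : g • w = h • (b i₀ : V) := congrArg Subtype.val hb
  -- A common nonunit factor could be cancelled from `g w = h b_{i₀}`, and then a proper divisor of
  -- `g` would already carry `w` into `Λ`.
  have hcop : IsCoprime h g := by
    refine isCoprime_of_dvd _ _ (fun hh => hg hh.2) ?_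
    rintro z hzu hz0 ⟨h', rfl⟩ ⟨g', rfl⟩
    have h1 : g' • w = h' • (b i₀ : V) := by
      apply smul_right_injective V hz0
      simpa only [mul_smul] using hb
    obtain ⟨k, hk⟩ := (hw g').1 (h1 ▸ Submodule.smul_mem _ _ (Subtype.mem _))
    refine hzu (IsUnit.of_mul_eq_one k ?_)
    apply mul_left_cancel₀ (right_ne_zero_of_mul hg)
    rw [mul_one]
    nth_rewrite 2 [hk]
    ring
  -- Bézout gives `z` with `g z = b_{i₀}` and `w = h z`. Replacing `b_{i₀}` by `z` turns a basis of
  -- `Λ` into one of `Λ'`, at the cost of the factor `g`.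
  obtain ⟨α, β, hαβ⟩ := hcop
  set z : V := α • w + β • (b i₀ : V) with hz
  have hgz : g • z = b i₀ := by
    rw [hz, smul_add, smul_comm g α, hb, ← mul_smul, ← mul_smul, ← add_smul, mul_comm g β, hαβ,
      one_smul]
  have hwz : w = h • z := by
    apply smul_right_injective V hg
    simp only [hb, ← hgz]
    rw [smul_comm]
  obtain ⟨u₁, hu₁⟩ := exists_units_smul_latticeDet_eq e Λ _ (span_range_coe_basis b)
  obtain ⟨u₂, hu₂⟩ := exists_units_smul_latticeDet_eq e Λ'
      (Function.update (fun i => (b i : V)) i₀ z) (by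
    apply le_antisymm
    · rw [Submodule.span_le]
      rintro _ ⟨i, rfl⟩
      by_cases hi : i = i₀
      · subst hi
        simp only [Function.update_self, SetLike.mem_coe, hz, hΛ']
        exact Submodule.add_mem _ (Submodule.smul_mem _ _ (Submodule.mem_sup_right
          (Submodule.mem_span_singleton_self w))) (Submodule.smul_mem _ _
          (Submodule.mem_sup_left (Subtype.mem _)))
      · simp only [Function.update_of_ne hi, SetLike.mem_coe, hΛ']
        exact Submodule.mem_sup_left (Subtype.mem _)
    · have hz' : z ∈ Submodule.span R (Set.range (Function.update (fun i => (b i : V)) i₀ z)) :=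
        Submodule.subset_span ⟨i₀, by simp⟩
      rw [hΛ', sup_le_iff, Submodule.span_singleton_le_iff_mem]
      refine ⟨?_, hwz ▸ Submodule.smul_mem _ _ hz'⟩
      conv_lhs => rw [← span_range_coe_basis b]
      rw [Submodule.span_le]
      rintro _ ⟨i, rfl⟩
      by_cases hi : i = i₀
      · subst hi
        simp only [SetLike.mem_coe, ← hgz]
        exact Submodule.smul_mem _ _ hz'
      · exact Submodule.subset_span ⟨i, by simp [hi]⟩)
  have hdet : e.det (fun i => (b i : V)) =
      g • e.det (Function.update (fun i => (b i : V)) i₀ z) := by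
    rw [← algebraMap_smul K g, ← e.det.map_update_smul, algebraMap_smul, hgz,
      Function.update_eq_self]
  refine ⟨u₁ * u₂⁻¹, ?_⟩
  rw [hu₁, hu₂, hdet, mul_smul, smul_comm g u₂, inv_smul_smul]

end LatticeDet


/-! ### Arithmetic of skew polynomials: coefficients, order, commutation of `τ` with scalars. -/

section Basics

variable {F : Type*} [Field F]

/-- The shift operator `τ`. -/
abbrev tau (F : Type*) [Field F] : Op F := SkewPolynomial.X

theorem shift_algebraMap (q : F[X]) :
    shift F (algebraMap F[X] (RatFunc F) q) = algebraMap F[X] (RatFunc F) (taylor 1 q) := by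
  rw [shift, RatFunc.coe_mapRingHom_eq_coe_map]
  have := RatFunc.map_apply_div (taylorEquiv (1 : F))
    (nonZeroDivisors_le_comap_nonZeroDivisors_of_injective _ (taylorEquiv (1 : F)).injective) q 1
  simpa [← coe_taylorEquiv] using this

theorem φ_eq_shift : (SkewPolynomial.φ : RatFunc F →+* RatFunc F) = shift F := by
  ext r
  change (powersHom (RatFunc F →+* RatFunc F) (shift F) (Multiplicative.ofAdd 1)) r = _
  simp

theorem ofAdd_smul_eq_shift_pow (n : ℕ) (r : RatFunc F) :
    Multiplicative.ofAdd n • r = (shift F ^ n) r := by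
  change (powersHom (RatFunc F →+* RatFunc F) (shift F) (Multiplicative.ofAdd n)) r = _
  simp

theorem shift_pow_algebraMap (n : ℕ) (q : F[X]) :
    (shift F ^ n) (algebraMap F[X] (RatFunc F) q) =
      algebraMap F[X] (RatFunc F) (taylor (n : F) q) := by
  induction n with
  | zero => simp
  | succ n ih =>
    rw [pow_succ', RingHom.mul_def, RingHom.comp_apply, ih, shift_algebraMap, taylor_taylor]
    simp [add_comm]

theorem tau_mul_smul_one (r : RatFunc F) : tau F * (r • 1) = (shift F r • 1) * tau F := by
  have h (s : RatFunc F) : s • (1 : Op F) = SkewPolynomial.monomial 0 s := by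
    rw [← SkewPolynomial.monomial_zero_one, SkewPolynomial.smul_monomial, smul_eq_mul, mul_one]
  rw [h, h, SkewPolynomial.X_mul_monomial, SkewPolynomial.monomial_mul_X, φ_eq_shift]

theorem monomial_eq_smul_tau_pow (n : ℕ) (r : RatFunc F) :
    SkewPolynomial.monomial n r = r • tau F ^ n := by
  rw [← SkewPolynomial.monomial_one_right_eq_X_pow, SkewPolynomial.smul_monomial, smul_eq_mul,
    mul_one]

theorem coeff_add (A B : Op F) (n : ℕ) : (A + B).coeff n = A.coeff n + B.coeff n := by
  simp

theorem coeff_sum {ι : Type*} (s : Finset ι) (A : ι → Op F) (n : ℕ) :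
    (∑ i ∈ s, A i).coeff n = ∑ i ∈ s, (A i).coeff n :=
  map_sum (AddMonoidHom.mk' (fun A : Op F => A.coeff n) fun A B => coeff_add A B n) A s

theorem eq_sum_range {A : Op F} {N : ℕ} (h : ∀ i, N ≤ i → A.coeff i = 0) :
    A = ∑ i ∈ Finset.range N, A.coeff i • tau F ^ i := by
  nth_rewrite 1 [← SkewPolynomial.sum_monomial A]
  rw [SkewPolynomial.sum_def]
  simp only [monomial_eq_smul_tau_pow]
  refine Finset.sum_subset (fun i hi => ?_) fun i _ hi => ?_
  · rw [Finset.mem_range]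
    by_contra! hN
    exact SkewPolynomial.mem_support_iff.1 hi (h i hN)
  · rw [SkewPolynomial.notMem_support_iff.1 hi, zero_smul]

theorem coeff_eq_zero_of_ord_lt {A : Op F} {i : ℕ} (h : ord A < i) : A.coeff i = 0 := by
  by_contra h0
  exact h.not_ge (Finset.le_sup (f := id) (SkewPolynomial.mem_support_iff.2 h0))

theorem coeff_ord_ne_zero {A : Op F} (h : A ≠ 0) : A.coeff (ord A) ≠ 0 := by
  have hs : A.support.Nonempty := by
    rw [Finset.nonempty_iff_ne_empty]
    exact fun h' => h (SkewPolynomial.support_eq_empty.1 h')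
  obtain ⟨i, hi, he⟩ := Finset.exists_mem_eq_sup _ hs id
  rw [ord, he]
  exact SkewPolynomial.mem_support_iff.1 hi

theorem ord_eq {A : Op F} {n : ℕ} (h : A.coeff n ≠ 0) (h' : ∀ i, n < i → A.coeff i = 0) :
    ord A = n := by
  apply le_antisymm
  · refine Finset.sup_le fun i hi => ?_
    by_contra! hn
    exact SkewPolynomial.mem_support_iff.1 hi (h' i hn)
  · by_contra! hn
    exact h (coeff_eq_zero_of_ord_lt hn)

variable {M : Type*} [AddCommGroup M] [Module (Op F) M] [Module (RatFunc F) M]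
  [IsScalarTower (RatFunc F) (Op F) M]

theorem tau_smul_smul (r : RatFunc F) (v : M) : tau F • r • v = shift F r • tau F • v := by
  rw [← smul_one_smul (Op F) r v, ← smul_one_smul (Op F) (shift F r) (tau F • v), ← mul_smul,
    ← mul_smul, tau_mul_smul_one]

theorem smul_eq_sum_range (A : Op F) {N : ℕ} (h : ∀ i, N ≤ i → A.coeff i = 0) (v : M) :
    A • v = ∑ i ∈ Finset.range N, A.coeff i • tau F ^ i • v := by
  nth_rewrite 1 [eq_sum_range h]
  rw [Finset.sum_smul]
  exact Finset.sum_congr rfl fun i _ => smul_assoc _ _ _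

variable [Module F[X] M] [IsScalarTower F[X] (RatFunc F) M]

theorem tau_smul_polynomial_smul (q : F[X]) (v : M) :
    tau F • q • v = taylor 1 q • tau F • v := by
  rw [← algebraMap_smul (RatFunc F) q v, tau_smul_smul, shift_algebraMap, algebraMap_smul]

theorem tau_pow_smul_polynomial_smul (n : ℕ) (q : F[X]) (v : M) :
    tau F ^ n • q • v = taylor (n : F) q • tau F ^ n • v := by
  induction n with
  | zero => simp
  | succ n ih =>
    rw [pow_succ', mul_smul, ih, tau_smul_polynomial_smul, taylor_taylor, ← mul_smul]
    simp [add_comm]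

end Basics

/-! ### Krylov lattices and their leading ideals. -/

section Krylov

variable {F : Type*} [Field F] {M : Type*} [AddCommGroup M] [Module (Op F) M] [Module F[X] M]

/-- The `F[x]`-submodule spanned by `m, τ m, …, τ ^ (n - 1) m`. -/
def krylov (F : Type*) {M : Type*} [Field F] [AddCommGroup M] [Module (Op F) M] [Module F[X] M]
    (m : M) (n : ℕ) : Submodule F[X] M :=
  Submodule.span F[X] (Set.range fun i : Fin n => tau F ^ (i : ℕ) • m)

/-- The polynomials `r` for which some operator of the form `r(x + n) τ ^ n + ⋯` with polynomial
coefficients annihilates `m`. -/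
def leadingIdeal (F : Type*) {M : Type*} [Field F] [AddCommGroup M] [Module (Op F) M]
    [Module F[X] M] (m : M) (n : ℕ) : Ideal F[X] :=
  Ideal.comap (taylorEquiv (n : F))
    ((krylov F m n).comap (LinearMap.toSpanSingleton F[X] M (tau F ^ n • m)))

theorem mem_leadingIdeal {m : M} {n : ℕ} {r : F[X]} :
    r ∈ leadingIdeal F m n ↔ taylor (n : F) r • tau F ^ n • m ∈ krylov F m n := Iff.rfl


theorem krylov_mono (m : M) : Monotone (krylov F m) := by
  intro a b hab
  refine Submodule.span_mono ?_
  rintro _ ⟨i, rfl⟩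
  exact ⟨⟨i, i.2.trans_le hab⟩, rfl⟩

theorem tau_pow_smul_mem_krylov (m : M) {i n : ℕ} (h : i < n) : tau F ^ i • m ∈ krylov F m n :=
  Submodule.subset_span ⟨⟨i, h⟩, rfl⟩

theorem krylov_succ (m : M) (n : ℕ) :
    krylov F m (n + 1) = krylov F m n ⊔ Submodule.span F[X] {tau F ^ n • m} := by
  apply le_antisymm
  · refine Submodule.span_le.2 ?_
    rintro _ ⟨⟨i, hi⟩, rfl⟩
    rcases Nat.lt_succ_iff_lt_or_eq.1 hi with h | rfl
    · exact Submodule.mem_sup_left (tau_pow_smul_mem_krylov m h)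
    · exact Submodule.mem_sup_right (Submodule.mem_span_singleton_self _)
  · rw [sup_le_iff, Submodule.span_singleton_le_iff_mem]
    exact ⟨krylov_mono m n.le_succ, tau_pow_smul_mem_krylov m n.lt_succ_self⟩

variable [Module (RatFunc F) M] [IsScalarTower (RatFunc F) (Op F) M]
  [IsScalarTower F[X] (RatFunc F) M]

theorem tau_smul_mem_krylov_succ {m v : M} {n : ℕ} (hv : v ∈ krylov F m n) :
    tau F • v ∈ krylov F m (n + 1) := by
  induction hv using Submodule.span_induction with
  | mem v hv =>
    obtain ⟨i, rfl⟩ := hv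
    rw [← mul_smul, ← pow_succ']
    exact tau_pow_smul_mem_krylov m (Nat.succ_lt_succ i.2)
  | zero => simp
  | add v w _ _ hv hw => rw [smul_add]; exact add_mem hv hw
  | smul q v _ hv => rw [tau_smul_polynomial_smul]; exact Submodule.smul_mem _ _ hv

theorem tau_pow_smul_mem_krylov_add {m v : M} {n : ℕ} (hv : v ∈ krylov F m n) (k : ℕ) :
    tau F ^ k • v ∈ krylov F m (n + k) := by
  induction k with
  | zero => simpa
  | succ k ih =>
    rw [pow_succ', mul_smul]
    exact tau_smul_mem_krylov_succ ih

/-- Applying `τ` to a relation with top coefficient `r(x + n)` gives one in degree `n + 1` with top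
coefficient `r(x + n + 1)`. The normalization `a_n(x - n)` makes `r` itself unchanged. -/
theorem leadingIdeal_mono (m : M) : Monotone (leadingIdeal F m) := by
  refine monotone_nat_of_le_succ fun n r hr => ?_
  rw [mem_leadingIdeal] at hr ⊢
  have := tau_smul_mem_krylov_succ hr
  rw [tau_smul_polynomial_smul, taylor_taylor, ← mul_smul, ← pow_succ'] at this
  simpa [add_comm] using this

theorem mem_krylov_iff {m v : M} {n : ℕ} : v ∈ krylov F m n ↔
    ∃ B : Op F, IsPolynomial B ∧ (∀ i, n ≤ i → B.coeff i = 0) ∧ v = B • m := by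
  constructor
  · intro hv
    obtain ⟨c, rfl⟩ := (Submodule.mem_span_range_iff_exists_fun _).1 hv
    have hc (i : ℕ) : (∑ j : Fin n, SkewPolynomial.monomial (j : ℕ)
        (algebraMap F[X] (RatFunc F) (c j)) : Op F).coeff i =
        if h : i < n then algebraMap F[X] (RatFunc F) (c ⟨i, h⟩) else 0 := by
      rw [coeff_sum]
      simp only [SkewPolynomial.coeff_monomial]
      split_ifs with h
      · rw [Finset.sum_eq_single ⟨i, h⟩]
        · simp
        · intro j _ hj
          exact if_neg fun h' => hj (Fin.ext h')
        · simp
      · exact Finset.sum_eq_zero fun j _ => if_neg fun h' : (j : ℕ) = i => h (h' ▸ j.2)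
    refine ⟨∑ j : Fin n, SkewPolynomial.monomial (j : ℕ) (algebraMap F[X] (RatFunc F) (c j)),
      fun i => ?_, fun i hi => ?_, ?_⟩
    · rw [hc]
      split_ifs with h
      · exact ⟨_, rfl⟩
      · exact ⟨0, by simp⟩
    · rw [hc, dif_neg hi.not_gt]
    · rw [Finset.sum_smul]
      refine Finset.sum_congr rfl fun j _ => ?_
      rw [monomial_eq_smul_tau_pow, smul_assoc, algebraMap_smul]
  · rintro ⟨B, hB, hn, rfl⟩
    rw [smul_eq_sum_range B hn]
    refine Submodule.sum_mem _ fun i hi => ?_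
    obtain ⟨q, hq⟩ := hB i
    rw [hq, algebraMap_smul]
    exact Submodule.smul_mem _ _ (tau_pow_smul_mem_krylov m (Finset.mem_range.1 hi))

theorem coeff_sub (A B : Op F) (n : ℕ) : (A - B).coeff n = A.coeff n - B.coeff n := by
  simp

/-- The ideal attached to `L` is computed by any module element whose annihilator is `𝓓 L`. -/
theorem lcIdeal_eq_iSup {L : Op F} {m : M}
    (h : ∀ A : Op F, A • m = 0 ↔ ∃ B : Op F, A = B * L) :
    lcIdeal L = ⨆ n, leadingIdeal F m n := by
  apply le_antisymm
  · refine Ideal.span_le.2 ?_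
    rintro _ ⟨A, -, hP, a, ha, rfl⟩
    refine (le_iSup (leadingIdeal F m) (ord (A * L))) ?_
    set n := ord (A * L)
    have hm := (h (A * L)).2 ⟨A, rfl⟩
    have htay : taylor (n : F) (a.comp (X - C (n : F))) = a := by
      simp [taylor_apply, comp_assoc]
    rw [mem_leadingIdeal, htay, ← neg_mem_iff]
    rw [smul_eq_sum_range (A * L) (N := n + 1) fun i hi => coeff_eq_zero_of_ord_lt hi,
      Finset.sum_range_succ, ha, algebraMap_smul, add_eq_zero_iff_eq_neg] at hm
    rw [← hm]
    refine Submodule.sum_mem _ fun i hi => ?_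
    obtain ⟨q, hq⟩ := hP i
    rw [hq, algebraMap_smul]
    exact Submodule.smul_mem _ _ (tau_pow_smul_mem_krylov m (Finset.mem_range.1 hi))
  · refine iSup_le fun n r hr => ?_
    rcases eq_or_ne r 0 with rfl | hr0
    · exact zero_mem _
    obtain ⟨B, hB, hBn, hBm⟩ := mem_krylov_iff.1 (mem_leadingIdeal.1 hr)
    -- The relation expressing membership, read as an operator killing `m`; it is therefore a left
    -- multiple of `L` with the prescribed leading coefficient.
    set T : Op F :=
      SkewPolynomial.monomial n (algebraMap F[X] (RatFunc F) (taylor (n : F) r)) - B with hT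
    obtain ⟨A, hA⟩ := (h T).1 (by
      rw [hT, sub_smul, ← hBm, monomial_eq_smul_tau_pow, smul_assoc, algebraMap_smul, sub_self])
    have hTn : T.coeff n = algebraMap F[X] (RatFunc F) (taylor (n : F) r) := by
      rw [hT, coeff_sub, hBn n le_rfl, SkewPolynomial.coeff_monomial, if_pos rfl, sub_zero]
    have hTn0 : T.coeff n ≠ 0 := by
      rw [hTn]
      simpa using hr0
    have hord : ord T = n := ord_eq hTn0 fun i hi => by
      rw [hT, coeff_sub, hBn i hi.le, SkewPolynomial.coeff_monomial, if_neg hi.ne, sub_zero]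
    refine Ideal.subset_span ⟨A, ?_, ?_, taylor (n : F) r, ?_, ?_⟩
    · rintro rfl
      rw [zero_mul] at hA
      exact hTn0 (by rw [hA, SkewPolynomial.coeff_zero])
    · rw [← hA]
      intro i
      obtain ⟨q, hq⟩ := hB i
      rw [hT, coeff_sub, hq, SkewPolynomial.coeff_monomial]
      split_ifs
      · exact ⟨_ - q, by rw [map_sub]⟩
      · exact ⟨-q, by rw [map_neg, zero_sub]⟩
    · rw [← hA, hord, hTn]
    · rw [← hA, hord]
      simp [taylor_apply, comp_assoc]

end Krylov


/-! ### The norm to shift invariant polynomials. -/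

section ShiftNorm

variable {F : Type*} [Field F]

/-- The product `q(x) q(x + 1) ⋯ q(x + p - 1)`; in characteristic `p` this is the norm of `q` from
`F(x)` to the subfield of shift invariant rational functions. -/
def shiftNorm (p : ℕ) (q : F[X]) : F[X] := ∏ i ∈ Finset.range p, taylor (i : F) q

theorem taylor_prod {ι : Type*} (s : Finset ι) (a : F) (f : ι → F[X]) :
    taylor a (∏ i ∈ s, f i) = ∏ i ∈ s, taylor a (f i) :=
  map_prod (taylorAlgHom a) f s

/-- Since `p = 0` in `F`, the shift permutes the factors cyclically. -/
theorem taylor_one_shiftNorm (p : ℕ) [CharP F p] (q : F[X]) :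
    taylor 1 (shiftNorm p q) = shiftNorm p q := by
  rw [shiftNorm, taylor_prod]
  simp only [taylor_taylor]
  rcases p with _ | p
  · simp
  rw [Finset.prod_range_succ, Finset.prod_range_succ', mul_comm]
  have h : (1 : F) + (p : F) = 0 := by
    have := CharP.cast_eq_zero F (p + 1)
    push_cast at this
    rw [add_comm, this]
  rw [h, mul_comm]
  simp [add_comm]

theorem taylor_natCast_eq_self {q : F[X]} (h : taylor 1 q = q) (n : ℕ) : taylor (n : F) q = q := by
  induction n with
  | zero => simp
  | succ n ih =>
    rw [Nat.cast_succ, ← taylor_taylor, h, ih]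

theorem shiftNorm_ne_zero (p : ℕ) {q : F[X]} (h : q ≠ 0) : shiftNorm p q ≠ 0 :=
  Finset.prod_ne_zero_iff.2 fun _ _ => by simpa using h

theorem dvd_shiftNorm {p : ℕ} (hp : 0 < p) (q : F[X]) : q ∣ shiftNorm p q := by
  have := Finset.dvd_prod_of_mem (fun i : ℕ => taylor (i : F) q) (Finset.mem_range.2 hp)
  simpa [shiftNorm] using this

/-- After removing the common factor of `a` and `b`, every power of what remains of `a` divides `c`,
so that remainder is a unit. -/
theorem dvd_of_forall_pow_dvd_mul_pow {R : Type*} [CommRing R] [IsDomain R] [IsPrincipalIdealRing R]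
    {a b c : R} (hc : c ≠ 0) (ha : a ≠ 0) (h : ∀ j : ℕ, a ^ j ∣ c * b ^ j) : a ∣ b := by
  obtain ⟨a', b', d, hab, rfl, rfl⟩ := UniqueFactorizationMonoid.exists_reduced_factors a ha b
  have hd := left_ne_zero_of_mul ha
  by_cases hu : IsUnit a'
  · exact mul_dvd_mul_left d hu.dvd
  · obtain ⟨n, hn⟩ := FiniteMultiplicity.of_not_isUnit hu hc
    refine absurd ?_ hn
    have h1 := h (n + 1)
    rw [mul_pow, mul_pow, mul_left_comm] at h1
    exact (hab.isCoprime.pow).dvd_of_dvd_mul_right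
      ((mul_dvd_mul_iff_left (pow_ne_zero _ hd)).1 h1)

end ShiftNorm

/-! ### Growth of the Krylov determinants and comparison of two cyclic vectors. -/

section Growth

open Module

variable {F : Type*} [Field F] {M : Type*} [AddCommGroup M] [Module (Op F) M] [Module F[X] M]

theorem smul_tau_pow_mem_krylov_iff {m : M} {n : ℕ} {g : F[X]}
    (h : ∀ r, r ∈ leadingIdeal F m n ↔ g ∣ r) (r : F[X]) :
    r • tau F ^ n • m ∈ krylov F m n ↔ taylor (n : F) g ∣ r := by
  have hr : r = taylor (n : F) (taylor (-(n : F)) r) := by simp [taylor_taylor]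
  nth_rewrite 1 [hr]
  nth_rewrite 2 [hr]
  rw [← mem_leadingIdeal, h]
  exact (map_dvd_iff (taylorEquiv (n : F))).symm

variable [Module (RatFunc F) M] [IsScalarTower F[X] (RatFunc F) M]

section

variable {ι : Type*} [Fintype ι] [DecidableEq ι]

theorem latticeDet_krylov_succ (e : Basis ι (RatFunc F) M) {m : M} {n : ℕ} {g : F[X]} (hg : g ≠ 0)
    (h : ∀ r, r ∈ leadingIdeal F m n ↔ g ∣ r) [Submodule.IsLattice (RatFunc F) (krylov F m n)]
    [Submodule.IsLattice (RatFunc F) (krylov F m (n + 1))] :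
    ∃ u : F[X]ˣ, latticeDet e (krylov F m n) =
      u • taylor (n : F) g • latticeDet e (krylov F m (n + 1)) :=
  exists_units_smul_latticeDet_sup_span e _ _ (tau F ^ n • m) _ (by simpa using hg)
    (krylov_succ m n) (smul_tau_pow_mem_krylov_iff h)

theorem latticeDet_krylov_add (e : Basis ι (RatFunc F) M) {m : M} {N : ℕ} {g : F[X]} (hg : g ≠ 0)
    (h : ∀ n, N ≤ n → ∀ r, r ∈ leadingIdeal F m n ↔ g ∣ r)
    (hL : ∀ n, N ≤ n → Submodule.IsLattice (RatFunc F) (krylov F m n))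
    {n : ℕ} (hn : N ≤ n) (k : ℕ) [Submodule.IsLattice (RatFunc F) (krylov F m n)] :
    ∀ [Submodule.IsLattice (RatFunc F) (krylov F m (n + k))],
    ∃ u : F[X]ˣ, latticeDet e (krylov F m n) =
      u • taylor (n : F) (shiftNorm k g) • latticeDet e (krylov F m (n + k)) := by
  induction k with
  | zero => exact ⟨1, by simp [shiftNorm]⟩
  | succ k ih =>
    intro _
    have := hL (n + k) (by omega)
    obtain ⟨u, hu⟩ := ih
    obtain ⟨v, hv⟩ := latticeDet_krylov_succ e (m := m) (n := n + k) hg (h _ (by omega))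
    refine ⟨u * v, ?_⟩
    rw [hu, hv, shiftNorm, shiftNorm, Finset.prod_range_succ, taylor_mul, taylor_taylor,
      Nat.cast_add]
    simp only [Units.smul_def, smul_smul, Units.val_mul]
    refine congrArg₂ (· • ·) ?_ rfl
    ring

/-- Over a full period the factor is the norm of `g`, which no longer depends on the starting index,
so `j` periods contribute a pure power. -/
theorem latticeDet_krylov_add_mul (p : ℕ) [CharP F p] (e : Basis ι (RatFunc F) M) {m : M} {N : ℕ}
    {g : F[X]} (hg : g ≠ 0) (h : ∀ n, N ≤ n → ∀ r, r ∈ leadingIdeal F m n ↔ g ∣ r)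
    (hL : ∀ n, N ≤ n → Submodule.IsLattice (RatFunc F) (krylov F m n)) (j : ℕ)
    [Submodule.IsLattice (RatFunc F) (krylov F m N)] :
    ∀ [Submodule.IsLattice (RatFunc F) (krylov F m (N + p * j))],
    ∃ u : F[X]ˣ, latticeDet e (krylov F m N) =
      u • shiftNorm p g ^ j • latticeDet e (krylov F m (N + p * j)) := by
  induction j with
  | zero => exact ⟨1, by simp⟩
  | succ j ih =>
    intro _
    have := hL (N + p * j) (by omega)
    have : Submodule.IsLattice (RatFunc F) (krylov F m (N + p * j + p)) := hL _ (by omega)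
    obtain ⟨u, hu⟩ := ih
    obtain ⟨v, hv⟩ := latticeDet_krylov_add e hg h hL (n := N + p * j) (by omega) p
    rw [taylor_natCast_eq_self (taylor_one_shiftNorm p g)] at hv
    refine ⟨u * v, ?_⟩
    rw [hu, hv, pow_succ]
    simp only [Units.smul_def, smul_smul, Units.val_mul]
    refine congrArg₂ (· • ·) ?_ (by simp only [mul_add, mul_one, add_assoc])
    ring

end

theorem coeff_smul (r : RatFunc F) (B : Op F) (i : ℕ) : (r • B).coeff i = r * B.coeff i := by
  simp [SkewPolynomial.coeff]

theorem exists_ne_zero_mul_isPolynomial (B : Op F) :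
    ∃ b : F[X], b ≠ 0 ∧ IsPolynomial (algebraMap F[X] (RatFunc F) b • B) := by
  classical
  obtain ⟨b, hb⟩ := IsLocalization.exist_integer_multiples_of_finset (nonZeroDivisors F[X])
    (B.support.image B.coeff)
  refine ⟨b, nonZeroDivisors.coe_ne_zero b, fun i => ?_⟩
  have hc := coeff_smul (algebraMap F[X] (RatFunc F) b) B i
  by_cases hi : B.coeff i = 0
  · exact ⟨0, by rw [hc, hi, mul_zero, map_zero]⟩
  · obtain ⟨q, hq⟩ := hb (B.coeff i)
      (Finset.mem_image_of_mem _ (SkewPolynomial.mem_support_iff.2 hi))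
    exact ⟨q, by rw [hc, hq, Algebra.smul_def]⟩

variable [IsScalarTower (RatFunc F) (Op F) M]

/-- From degree `N` on, `g(x + k) τ ^ k m` lies in the span of lower powers; as `g ≠ 0` is
invertible in `F(x)`, the first `N` powers span `M`. -/
theorem isLattice_krylov {m : M} {N : ℕ} {g : F[X]} (hg : g ≠ 0)
    (h : ∀ n, N ≤ n → ∀ r, r ∈ leadingIdeal F m n ↔ g ∣ r) (hm : ∀ v : M, ∃ A : Op F, v = A • m)
    {n : ℕ} (hn : N ≤ n) : Submodule.IsLattice (RatFunc F) (krylov F m n) := by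
  have hfg (k : ℕ) : (krylov F m k).FG := Submodule.fg_span (Set.finite_range _)
  suffices Submodule.IsLattice (RatFunc F) (krylov F m N) from
    Submodule.IsLattice.of_le_of_isLattice_of_fg (RatFunc F) (krylov_mono m hn) (hfg n)
  refine ⟨hfg N, ?_⟩
  set S := Submodule.span (RatFunc F) (krylov F m N : Set M) with hS
  have hpow (k : ℕ) : tau F ^ k • m ∈ S := by
    induction k using Nat.strong_induction_on with
    | _ k ih =>
      rcases lt_or_ge k N with hk | hk
      · exact Submodule.subset_span (tau_pow_smul_mem_krylov m hk)
      · have h1 := (smul_tau_pow_mem_krylov_iff (h k hk) _).2 dvd_rfl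
        have h2 : krylov F m k ≤ S.restrictScalars F[X] := by
          refine Submodule.span_le.2 ?_
          rintro _ ⟨i, rfl⟩
          exact ih i i.2
        have h3 : algebraMap F[X] (RatFunc F) (taylor (k : F) g) • tau F ^ k • m ∈ S := by
          rw [algebraMap_smul]
          exact h2 h1
        refine (S.smul_mem_iff ?_).1 h3
        simpa using hg
  rw [eq_top_iff]
  rintro v -
  obtain ⟨A, rfl⟩ := hm v
  rw [smul_eq_sum_range A (N := ord A + 1) fun i hi => coeff_eq_zero_of_ord_lt hi]
  exact Submodule.sum_mem _ fun i _ => S.smul_mem _ (hpow i)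

/-- The denominator `b` of `B` is enlarged to its norm, which is shift invariant and so commutes
with every `τ ^ i`. This is what lets a single `c` serve all `n`. -/
theorem exists_smul_mem_krylov_add (p : ℕ) [Fact p.Prime] [CharP F p] (m m' : M)
    (hm : ∃ B : Op F, m' = B • m) :
    ∃ c : F[X], c ≠ 0 ∧ ∃ k, ∀ n, ∀ v ∈ krylov F m' n, c • v ∈ krylov F m (n + k) := by
  obtain ⟨B, rfl⟩ := hm
  obtain ⟨b, hb0, hb⟩ := exists_ne_zero_mul_isPolynomial B
  have hbm : b • B • m ∈ krylov F m (ord B + 1) := by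
    refine mem_krylov_iff.2 ⟨_, hb, fun i hi => ?_, ?_⟩
    · rw [coeff_smul, coeff_eq_zero_of_ord_lt hi, mul_zero]
    · rw [smul_assoc, algebraMap_smul]
  refine ⟨shiftNorm p b, shiftNorm_ne_zero p hb0, ord B + 1, fun n v hv => ?_⟩
  have hcm : shiftNorm p b • B • m ∈ krylov F m (ord B + 1) := by
    obtain ⟨q, hq⟩ := dvd_shiftNorm (Fact.out : p.Prime).pos b
    rw [hq, mul_comm, mul_smul]
    exact Submodule.smul_mem _ _ hbm
  suffices krylov F (B • m) n ≤ (krylov F m (n + (ord B + 1))).comap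
      (LinearMap.lsmul F[X] M (shiftNorm p b)) from this hv
  refine Submodule.span_le.2 ?_
  rintro _ ⟨i, rfl⟩
  rw [SetLike.mem_coe, Submodule.mem_comap, LinearMap.lsmul_apply]
  nth_rewrite 1 [← taylor_natCast_eq_self (taylor_one_shiftNorm p b) i]
  rw [← tau_pow_smul_polynomial_smul]
  exact krylov_mono m (by omega) (tau_pow_smul_mem_krylov_add hcm i)

theorem shiftNorm_dvd_shiftNorm (p : ℕ) [Fact p.Prime] [CharP F p] {m m' : M} {N N' : ℕ}
    {g g' : F[X]} (hg : g ≠ 0) (hg' : g' ≠ 0)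
    (h : ∀ n, N ≤ n → ∀ r, r ∈ leadingIdeal F m n ↔ g ∣ r)
    (h' : ∀ n, N' ≤ n → ∀ r, r ∈ leadingIdeal F m' n ↔ g' ∣ r)
    (hm : ∀ v : M, ∃ A : Op F, v = A • m) (hm' : ∀ v : M, ∃ A : Op F, v = A • m') :
    shiftNorm p g' ∣ shiftNorm p g := by
  classical
  have hp := (Fact.out : p.Prime).pos
  have hL (n : ℕ) (hn : N ≤ n) := isLattice_krylov hg h hm hn
  have hL' (n : ℕ) (hn : N' ≤ n) := isLattice_krylov hg' h' hm' hn
  have : Module.Finite (RatFunc F) M := by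
    refine ⟨?_⟩
    rw [← (hL N le_rfl).span_eq_top, krylov, Submodule.span_span_of_tower]
    exact Submodule.fg_span (Set.finite_range _)
  let e := Module.finBasis (RatFunc F) M
  obtain ⟨c, hc, k, hk⟩ := exists_smul_mem_krylov_add p m m' (hm m')
  have := hL N le_rfl
  have := hL' N' le_rfl
  -- The ratio of the two initial determinants, written as a fraction `a / b`.
  obtain ⟨a, b, hb, hab⟩ := IsFractionRing.div_surjective (A := F[X])
    (latticeDet e (krylov F m' N') / latticeDet e (krylov F m N))
  have hD := latticeDet_ne_zero e (krylov F m N)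
  have hD' := latticeDet_ne_zero e (krylov F m' N')
  have hb0 : algebraMap F[X] (RatFunc F) b ≠ 0 := by
    simpa using nonZeroDivisors.ne_zero hb
  have hab' : a • latticeDet e (krylov F m N) = b • latticeDet e (krylov F m' N') := by
    rw [Algebra.smul_def, Algebra.smul_def]
    field_simp at hab
    linear_combination hab
  have ha0 : a ≠ 0 := by
    rintro rfl
    rw [map_zero, zero_div] at hab
    exact div_ne_zero hD' hD hab.symm
  set d := Fintype.card (Fin (Module.finrank (RatFunc F) M))
  -- The constant collects `c ^ d` from the inclusion of lattices, `a` from the initial ratio, and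
  -- `N' + k` extra periods. Those periods guarantee `N' + p j + k ≤ N + p (j + N' + k)`, so the
  -- inclusion lands in a lattice reached by whole periods.
  refine dvd_of_forall_pow_dvd_mul_pow
    (c := c ^ d * a * shiftNorm p g ^ (N' + k)) (mul_ne_zero (mul_ne_zero (pow_ne_zero _ hc) ha0)
    (pow_ne_zero _ (shiftNorm_ne_zero p hg))) (shiftNorm_ne_zero p hg') fun j => ?_
  have := hL (N + p * (j + (N' + k))) (by omega)
  have := hL' (N' + p * j) (by omega)
  obtain ⟨u, hu⟩ := latticeDet_krylov_add_mul p e hg h hL (j + (N' + k))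
  obtain ⟨u', hu'⟩ := latticeDet_krylov_add_mul p e hg' h' hL' j
  obtain ⟨r, hr⟩ := exists_pow_smul_latticeDet_eq_smul e (krylov F m' (N' + p * j))
    (krylov F m (N + p * (j + (N' + k)))) c fun v hv => krylov_mono m (by nlinarith) (hk _ v hv)
  have hDj := latticeDet_ne_zero e (krylov F m (N + p * (j + (N' + k))))
  rw [hu, hu'] at hab'
  have key : c ^ d * a * u * shiftNorm p g ^ (j + (N' + k)) =
      b * u' * shiftNorm p g' ^ j * r := by
    apply IsFractionRing.injective F[X] (RatFunc F)
    apply mul_right_cancel₀ hDj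
    simp only [Units.smul_def, Algebra.smul_def, map_mul, map_pow] at hab' hr ⊢
    linear_combination (algebraMap F[X] (RatFunc F) c) ^ d * hab' +
      algebraMap F[X] (RatFunc F) b * algebraMap F[X] (RatFunc F) u' *
      (algebraMap F[X] (RatFunc F) (shiftNorm p g')) ^ j * hr
  have : shiftNorm p g' ^ j ∣ (c ^ d * a * shiftNorm p g ^ (N' + k) * shiftNorm p g ^ j) * u :=
    ⟨b * u' * r, by linear_combination key⟩
  exact (Units.dvd_mul_right).1 this

end Growth


/-! ### The norm of `𝔩𝔠_∞` is an isomorphism invariant. -/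

section NormInvariance

variable {F : Type*} [Field F]

theorem monomial_zero_mul (r : RatFunc F) (A : Op F) :
    SkewPolynomial.monomial 0 r * A = r • A := by
  induction A using SkewPolynomial.induction with
  | h0 => simp
  | ha n s A _ _ ih =>
    rw [mul_add, ih, smul_add, SkewPolynomial.monomial_mul_monomial, SkewPolynomial.smul_monomial]
    simp

theorem lcIdeal_ne_bot {L : Op F} (hL : L ≠ 0) : lcIdeal L ≠ ⊥ := by
  obtain ⟨b, hb0, hb⟩ := exists_ne_zero_mul_isPolynomial L
  rw [← monomial_zero_mul] at hb
  have hb0' : algebraMap F[X] (RatFunc F) b ≠ 0 := by simpa using hb0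
  have hbL : SkewPolynomial.monomial 0 (algebraMap F[X] (RatFunc F) b) * L ≠ 0 := by
    rw [monomial_zero_mul]
    exact smul_ne_zero hb0' hL
  obtain ⟨a, ha⟩ := hb (ord (SkewPolynomial.monomial 0 (algebraMap F[X] (RatFunc F) b) * L))
  have ha0 := coeff_ord_ne_zero hbL
  rw [ha] at ha0
  replace ha0 : a ≠ 0 := by simpa using ha0
  rw [Submodule.ne_bot_iff]
  refine ⟨_, Ideal.subset_span ⟨_, ?_, hb, a, ha, rfl⟩, ?_⟩
  · rwa [Ne, SkewPolynomial.monomial_eq_zero_iff]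
  · rw [sub_eq_add_neg, ← C_neg, ← taylor_apply]
    simpa using ha0

/-- `F[x]` is Noetherian, so the increasing chain of leading ideals reaches its union. -/
theorem exists_forall_mem_leadingIdeal_iff {M : Type*} [AddCommGroup M] [Module (Op F) M]
    [Module F[X] M] [Module (RatFunc F) M] [IsScalarTower F[X] (RatFunc F) M]
    [IsScalarTower (RatFunc F) (Op F) M] {L : Op F} {m : M}
    (h : ∀ A : Op F, A • m = 0 ↔ ∃ B : Op F, A = B * L) :
    ∃ N, ∀ n, N ≤ n → ∀ r,
      r ∈ leadingIdeal F m n ↔ Submodule.IsPrincipal.generator (lcIdeal L) ∣ r := by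
  let f : ℕ →o Ideal F[X] := ⟨leadingIdeal F m, leadingIdeal_mono m⟩
  obtain ⟨N, hN⟩ := WellFoundedGT.monotone_chain_condition f
  have hsup : lcIdeal L = leadingIdeal F m N := by
    rw [lcIdeal_eq_iSup h]
    refine le_antisymm (iSup_le fun n => ?_) (le_iSup _ N)
    rcases le_total N n with hn | hn
    · exact (hN n hn).ge
    · exact leadingIdeal_mono m hn
  refine ⟨N, fun n hn r => ?_⟩
  rw [← Submodule.IsPrincipal.mem_iff_generator_dvd, hsup]
  have := hN n hn
  change leadingIdeal F m N = leadingIdeal F m n at this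
  rw [this]

theorem shiftNorm_generator_dvd (p : ℕ) [Fact p.Prime] [CharP F p] {M : Type*} [AddCommGroup M]
    [Module (Op F) M] {L L' : Op F} (hL : L ≠ 0) (hL' : L' ≠ 0) {m m' : M}
    (h : ∀ A : Op F, A • m = 0 ↔ ∃ B : Op F, A = B * L)
    (h' : ∀ A : Op F, A • m' = 0 ↔ ∃ B : Op F, A = B * L')
    (hm : ∀ v : M, ∃ A : Op F, v = A • m) (hm' : ∀ v : M, ∃ A : Op F, v = A • m') :
    shiftNorm p (Submodule.IsPrincipal.generator (lcIdeal L')) ∣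
      shiftNorm p (Submodule.IsPrincipal.generator (lcIdeal L)) := by
  let : Module (RatFunc F) M :=
    Module.compHom M (SkewPolynomial.CRingHom : RatFunc F →+* SkewPolynomial (RatFunc F))
  let : Module F[X] M := Module.compHom M (algebraMap F[X] (RatFunc F))
  have : IsScalarTower (RatFunc F) (Op F) M := ⟨fun r A v => by
    rw [← monomial_zero_mul, mul_smul]
    rfl⟩
  have : IsScalarTower F[X] (RatFunc F) M := ⟨fun q r v => by
    rw [Algebra.smul_def, mul_smul]
    rfl⟩
  have hg {L : Op F} (hL : L ≠ 0) : Submodule.IsPrincipal.generator (lcIdeal L) ≠ 0 := fun h0 =>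
    lcIdeal_ne_bot hL ((Submodule.IsPrincipal.eq_bot_iff_generator_eq_zero _).2 h0)
  obtain ⟨N, hN⟩ := exists_forall_mem_leadingIdeal_iff h
  obtain ⟨N', hN'⟩ := exists_forall_mem_leadingIdeal_iff h'
  exact shiftNorm_dvd_shiftNorm p (hg hL) (hg hL') hN hN' hm hm'

/-- Both cyclic vectors are taken in `𝓓 / 𝓓 L₂`: the class of `1`, and the image under `φ` of the
class of `1`, whose annihilator is `𝓓 L₁`. -/
theorem associated_shiftNorm_of_linearEquiv (p : ℕ) [Fact p.Prime] [CharP F p] {L₁ L₂ : Op F}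
    (h₁ : L₁ ≠ 0) (h₂ : L₂ ≠ 0) (φ : QuotientModule L₁ ≃ₗ[Op F] QuotientModule L₂) :
    Associated (shiftNorm p (Submodule.IsPrincipal.generator (lcIdeal L₁)))
      (shiftNorm p (Submodule.IsPrincipal.generator (lcIdeal L₂))) := by
  have hmk (L A : Op F) : (Submodule.Quotient.mk A : QuotientModule L) =
      A • (Submodule.Quotient.mk 1 : QuotientModule L) := by
    rw [← Submodule.Quotient.mk_smul, smul_eq_mul, mul_one]
  have hgen (L : Op F) (v : QuotientModule L) :
      ∃ A : Op F, v = A • (Submodule.Quotient.mk 1 : QuotientModule L) := by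
    obtain ⟨A, rfl⟩ := Submodule.Quotient.mk_surjective _ v
    exact ⟨A, hmk L A⟩
  have hann (L A : Op F) : A • (Submodule.Quotient.mk 1 : QuotientModule L) = 0 ↔
      ∃ B : Op F, A = B * L := by
    rw [← hmk, Submodule.Quotient.mk_eq_zero, Submodule.mem_span_singleton]
    exact exists_congr fun B => eq_comm
  have hgen' (v : QuotientModule L₂) :
      ∃ A : Op F, v = A • φ (Submodule.Quotient.mk 1 : QuotientModule L₁) := by
    obtain ⟨A, hA⟩ := hgen L₁ (φ.symm v)
    exact ⟨A, by rw [← map_smul, ← hA, φ.apply_symm_apply]⟩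
  have hann' (A : Op F) : A • φ (Submodule.Quotient.mk 1 : QuotientModule L₁) = 0 ↔
      ∃ B : Op F, A = B * L₁ := by
    rw [← map_smul, φ.map_eq_zero_iff, hann]
  exact associated_of_dvd_dvd
    (shiftNorm_generator_dvd p h₂ h₁ (hann L₂) hann' (hgen L₂) hgen')
    (shiftNorm_generator_dvd p h₁ h₂ hann' (hann L₂) hgen' (hgen L₂))

end NormInvariance

/-! ### From associated norms to matched factors and shift equivalence. -/

section Factors

variable {F : Type*} [Field F]

theorem shiftNorm_mul (p : ℕ) (a b : F[X]) :
    shiftNorm p (a * b) = shiftNorm p a * shiftNorm p b := by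
  simp only [shiftNorm, taylor_mul, Finset.prod_mul_distrib]

theorem shiftNorm_taylor (p : ℕ) [CharP F p] (n : ℕ) (q : F[X]) :
    shiftNorm p (taylor (n : F) q) = shiftNorm p q := by
  rw [← taylor_natCast_eq_self (taylor_one_shiftNorm p q) n, shiftNorm, shiftNorm, taylor_prod]
  simp only [taylor_taylor, add_comm]

theorem shiftNorm_dvd_of_dvd (p : ℕ) {a b : F[X]} (h : a ∣ b) : shiftNorm p a ∣ shiftNorm p b := by
  obtain ⟨c, rfl⟩ := h
  exact ⟨_, shiftNorm_mul p a c⟩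

/-- Products of monic irreducible polynomials with the same norm are matched by shifts. -/
theorem rel_shift_of_associated_shiftNorm (p : ℕ) [Fact p.Prime] [CharP F p] (s t : Multiset F[X])
    (hs : ∀ q ∈ s, Irreducible q ∧ q.Monic) (ht : ∀ q ∈ t, Irreducible q ∧ q.Monic)
    (h : Associated (shiftNorm p s.prod) (shiftNorm p t.prod)) :
    Multiset.Rel (fun q₁ q₂ : F[X] => ∃ n : ℤ, q₂ = q₁.comp (X + C (n : F))) s t := by
  have hp := (Fact.out : p.Prime).pos
  induction s using Multiset.induction generalizing t with
  | empty =>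
    rw [Multiset.rel_zero_left]
    refine Multiset.eq_zero_of_forall_notMem fun q hq => (ht q hq).1.not_isUnit ?_
    have h1 : q ∣ shiftNorm p (0 : Multiset F[X]).prod :=
      ((Multiset.dvd_prod hq).trans (dvd_shiftNorm hp _)).trans h.symm.dvd
    refine isUnit_of_dvd_one (h1.trans ?_)
    simp [shiftNorm]
  | cons q s ih =>
    have hq := hs q (Multiset.mem_cons_self q s)
    have hdvd : q ∣ shiftNorm p t.prod := by
      refine dvd_trans ?_ h.dvd
      rw [Multiset.prod_cons]
      exact (dvd_mul_right _ _).trans (dvd_shiftNorm hp _)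
    obtain ⟨i, -, hi⟩ := (hq.1.prime.dvd_finsetProd_iff _).1 hdvd
    -- Undoing the shift: a translate of `q` divides the product of `t`, hence equals one of its
    -- monic irreducible members.
    have hi' : taylor (-(i : F)) q ∣ t.prod := by
      have := (map_dvd_iff (taylorEquiv (-(i : F)))).2 hi
      change taylor (-(i : F)) q ∣ taylor (-(i : F)) (taylor (i : F) t.prod) at this
      simpa only [taylor_taylor, neg_add_cancel, taylor_zero] using this
    have hirr : Irreducible (taylor (-(i : F)) q) :=
      (MulEquiv.irreducible_iff (taylorEquiv (-(i : F)))).2 hq.1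
    obtain ⟨q', hq't, hq'⟩ := hirr.prime.exists_mem_multiset_dvd hi'
    have hmon : (taylor (-(i : F)) q).Monic := by
      rw [Monic, leadingCoeff_taylor, hq.2]
    have heq : taylor (-(i : F)) q = q' :=
      eq_of_monic_of_associated hmon (ht q' hq't).2 (hirr.associated_of_dvd (ht q' hq't).1 hq')
    have hqq' : q = taylor (i : F) q' := by rw [← heq, taylor_taylor]; simp
    obtain ⟨t, rfl⟩ := Multiset.exists_cons_of_mem hq't
    refine Multiset.Rel.cons ⟨-(i : ℤ), ?_⟩ (ih t (fun r hr => hs r (Multiset.mem_cons_of_mem hr))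
      (fun r hr => ht r (Multiset.mem_cons_of_mem hr)) ?_)
    · rw [← heq, taylor_apply]
      simp
    · rw [Multiset.prod_cons, Multiset.prod_cons, shiftNorm_mul, shiftNorm_mul] at h
      -- The matched factors are shifts of each other, so their norms agree and cancel.
      refine Associated.of_mul_left h ?_ (shiftNorm_ne_zero p hq.1.ne_zero)
      rw [hqq', shiftNorm_taylor]
      exact Associated.refl _

theorem ShiftEquivalent.symm {r₁ r₂ : RatFunc F} (h : ShiftEquivalent r₁ r₂) :
    ShiftEquivalent r₂ r₁ := by
  obtain ⟨f, hf, h⟩ := h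
  exact ⟨f⁻¹, inv_ne_zero hf, by rw [← inv_div, h, map_inv₀, inv_div, inv_div_inv]⟩

theorem ShiftEquivalent.mul {r₁ r₂ s₁ s₂ : RatFunc F} (h : ShiftEquivalent r₁ r₂)
    (h' : ShiftEquivalent s₁ s₂) : ShiftEquivalent (r₁ * s₁) (r₂ * s₂) := by
  obtain ⟨f, hf, h⟩ := h
  obtain ⟨f', hf', h'⟩ := h'
  exact ⟨f * f', mul_ne_zero hf hf', by rw [mul_div_mul_comm, h, h', map_mul, mul_div_mul_comm]⟩

/-- The witness `f = q(x) q(x + 1) ⋯ q(x + n - 1)` makes `f(x + 1) / f(x)` telescope. -/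
theorem shiftEquivalent_taylor_natCast {q : F[X]} (hq : q ≠ 0) (n : ℕ) :
    ShiftEquivalent (algebraMap F[X] (RatFunc F) (taylor (n : F) q))
      (algebraMap F[X] (RatFunc F) q) := by
  have h0 (a : F) : algebraMap F[X] (RatFunc F) (taylor a q) ≠ 0 := by simpa using hq
  refine ⟨algebraMap F[X] (RatFunc F) (∏ i ∈ Finset.range n, taylor (i : F) q), ?_, ?_⟩
  · rw [map_prod]
    exact Finset.prod_ne_zero_iff.2 fun i _ => h0 i
  · rw [shift_algebraMap, taylor_prod]
    simp only [taylor_taylor, map_prod]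
    have h1 := Finset.prod_range_succ (fun i : ℕ => algebraMap F[X] (RatFunc F) (taylor (i : F) q)) n
    rw [Finset.prod_range_succ'] at h1
    have h2 : ∏ i ∈ Finset.range n, algebraMap F[X] (RatFunc F) (taylor (i : F) q) ≠ 0 :=
      Finset.prod_ne_zero_iff.2 fun i _ => h0 i
    have h3 : algebraMap F[X] (RatFunc F) q ≠ 0 := by simpa using hq
    rw [div_eq_div_iff h3 h2]
    simp only [Nat.cast_zero, taylor_zero, Nat.cast_succ] at h1
    rw [mul_comm, ← h1]
    simp only [add_comm]

theorem shiftEquivalent_comp_intCast {q : F[X]} (hq : q ≠ 0) (n : ℤ) :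
    ShiftEquivalent (algebraMap F[X] (RatFunc F) q)
      (algebraMap F[X] (RatFunc F) (q.comp (X + C (n : F)))) := by
  rw [← taylor_apply]
  obtain ⟨k, rfl | rfl⟩ := n.eq_nat_or_neg
  · simpa using (shiftEquivalent_taylor_natCast hq k).symm
  · have := shiftEquivalent_taylor_natCast (q := taylor (-(k : F)) q) (by simpa using hq) k
    simpa [taylor_taylor] using this

theorem shiftEquivalent_prod_of_rel {s t : Multiset F[X]} (hs : ∀ q ∈ s, q ≠ 0)
    (h : Multiset.Rel (fun q₁ q₂ : F[X] => ∃ n : ℤ, q₂ = q₁.comp (X + C (n : F))) s t) :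
    ShiftEquivalent (algebraMap F[X] (RatFunc F) s.prod)
      (algebraMap F[X] (RatFunc F) t.prod) := by
  induction h with
  | zero => exact ⟨1, one_ne_zero, by simp⟩
  | cons h _ ih =>
    obtain ⟨n, rfl⟩ := h
    rw [Multiset.prod_cons, Multiset.prod_cons, map_mul, map_mul]
    exact (shiftEquivalent_comp_intCast (hs _ (Multiset.mem_cons_self _ _)) n).mul
      (ih fun q hq => hs q (Multiset.mem_cons_of_mem hq))

theorem lcInf_ne_zero {L : Op F} (hL : L ≠ 0) : lcInf L ≠ 0 := by
  classical
  rw [lcInf, Ne, normalize_eq_zero, ← Submodule.IsPrincipal.eq_bot_iff_generator_eq_zero]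
  exact lcIdeal_ne_bot hL

theorem lcInf_associated (L : Op F) :
    Associated (lcInf L) (Submodule.IsPrincipal.generator (lcIdeal L)) := by
  classical
  exact normalize_associated _

theorem prod_trueSingularities {L : Op F} (hL : L ≠ 0) : (trueSingularities L).prod = lcInf L := by
  classical
  rw [trueSingularities, UniqueFactorizationMonoid.prod_normalizedFactors_eq (lcInf_ne_zero hL),
    lcInf, normalize_idem]

theorem irreducible_monic_of_mem_trueSingularities {L : Op F} {q : F[X]}
    (hq : q ∈ trueSingularities L) : Irreducible q ∧ q.Monic := by
  classical
  have h := UniqueFactorizationMonoid.irreducible_of_normalized_factor q hq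
  refine ⟨h, ?_⟩
  rw [← UniqueFactorizationMonoid.normalize_normalized_factor q hq]
  exact monic_normalize h.ne_zero

theorem shiftEquivalent_and_sameTrueSingularities (p : ℕ) [Fact p.Prime] [CharP F p] {L₁ L₂ : Op F}
    (h₁ : L₁ ≠ 0) (h₂ : L₂ ≠ 0) (φ : QuotientModule L₁ ≃ₗ[Op F] QuotientModule L₂) :
    ShiftEquivalent (algebraMap F[X] (RatFunc F) (lcInf L₁))
      (algebraMap F[X] (RatFunc F) (lcInf L₂)) ∧ SameTrueSingularitiesUpToShifts L₁ L₂ := by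
  have hlc (L : Op F) : Associated (shiftNorm p (lcInf L))
      (shiftNorm p (Submodule.IsPrincipal.generator (lcIdeal L))) :=
    associated_of_dvd_dvd (shiftNorm_dvd_of_dvd p (lcInf_associated L).dvd)
      (shiftNorm_dvd_of_dvd p (lcInf_associated L).symm.dvd)
  have hrel : SameTrueSingularitiesUpToShifts L₁ L₂ := by
    refine rel_shift_of_associated_shiftNorm p _ _
      (fun q hq => irreducible_monic_of_mem_trueSingularities hq)
      (fun q hq => irreducible_monic_of_mem_trueSingularities hq) ?_
    rw [prod_trueSingularities h₁, prod_trueSingularities h₂]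
    exact ((hlc L₁).trans (associated_shiftNorm_of_linearEquiv p h₁ h₂ φ)).trans (hlc L₂).symm
  refine ⟨?_, hrel⟩
  rw [← prod_trueSingularities h₁, ← prod_trueSingularities h₂]
  exact shiftEquivalent_prod_of_rel
    (fun q hq => (irreducible_monic_of_mem_trueSingularities hq).1.ne_zero) hrel

end Factors


/-! ### The counterexample in characteristic zero. -/

section CharZero

variable {F : Type*} [Field F]

theorem algebraMap_ne_zero {q : F[X]} (hq : q ≠ 0) : algebraMap F[X] (RatFunc F) q ≠ 0 :=
  (map_ne_zero_iff _ (IsFractionRing.injective F[X] (RatFunc F))).2 hq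

theorem coeff_mul_monomial_zero (A : Op F) (r : RatFunc F) (i : ℕ) :
    (A * SkewPolynomial.monomial 0 r).coeff i = A.coeff i * (shift F ^ i) r := by
  induction A using SkewPolynomial.induction with
  | h0 => simp
  | ha n s A _ _ ih =>
    rw [add_mul, coeff_add, coeff_add, ih, add_mul, SkewPolynomial.monomial_mul_monomial,
      SkewPolynomial.coeff_monomial, SkewPolynomial.coeff_monomial, SkewPolynomial.φ_iterate_apply,
      ofAdd_smul_eq_shift_pow, add_zero]
    split_ifs with h
    · rw [h]
    · rw [zero_mul]

theorem coeff_mul_tau_zero (A : Op F) : (A * tau F).coeff 0 = 0 := by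
  induction A using SkewPolynomial.induction with
  | h0 => simp
  | ha n s A _ _ ih =>
    rw [add_mul, coeff_add, ih, SkewPolynomial.monomial_mul_X, SkewPolynomial.coeff_monomial,
      if_neg n.succ_ne_zero, add_zero]

theorem coeff_mul_tau_succ (A : Op F) (i : ℕ) : (A * tau F).coeff (i + 1) = A.coeff i := by
  induction A using SkewPolynomial.induction with
  | h0 => simp
  | ha n s A _ _ ih =>
    rw [add_mul, coeff_add, coeff_add, ih, SkewPolynomial.monomial_mul_X,
      SkewPolynomial.coeff_monomial, SkewPolynomial.coeff_monomial]
    simp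

/-- A left multiple of `τ - 1` annihilates the constants: its coefficients sum to zero. -/
theorem sum_coeff_mul_tau_sub_one (A : Op F) {N : ℕ}
    (h : ∀ i, N ≤ i → (A * (tau F - 1)).coeff i = 0) :
    ∑ i ∈ Finset.range N, (A * (tau F - 1)).coeff i = 0 := by
  -- The range is extended beyond the order of `A`, so that `A τ` and `A` have the same coefficient
  -- sum over it.
  set n := max N (ord A + 1)
  have hsub : ∑ i ∈ Finset.range N, (A * (tau F - 1)).coeff i =
      ∑ i ∈ Finset.range (n + 1), (A * (tau F - 1)).coeff i :=
    Finset.sum_subset (Finset.range_mono ((le_max_left _ _).trans n.le_succ)) fun i _ hi =>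
      h i (by simpa using hi)
  rw [hsub, mul_sub, mul_one]
  simp only [coeff_sub]
  rw [Finset.sum_sub_distrib, Finset.sum_range_succ', Finset.sum_range_succ _ n,
    coeff_mul_tau_zero, coeff_eq_zero_of_ord_lt (lt_of_lt_of_le (Nat.lt_succ_self _)
      (le_max_right N (ord A + 1)))]
  simp only [coeff_mul_tau_succ, sub_self]

/-- If `∑ tᵢ(x) / (x + i) = 0` with polynomials `tᵢ`, then `tₙ` vanishes at `-n`. -/
theorem eval_neg_eq_zero_of_sum_eq_zero [CharZero F] {n : ℕ} (t : ℕ → F[X]) (s : ℕ → RatFunc F)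
    (hts : ∀ i, algebraMap F[X] (RatFunc F) (t i) =
      s i * algebraMap F[X] (RatFunc F) (X + C (i : F)))
    (hs : ∑ i ∈ Finset.range (n + 1), s i = 0) : (t n).eval (-(n : F)) = 0 := by
  -- Denominators are cleared by `∏ (x + j)`. At `-n` only the term `i = n` survives, and its
  -- cofactor is nonzero because the integers `j` are distinct in `F`.
  have h1 : ∑ i ∈ Finset.range (n + 1),
      t i * ∏ j ∈ (Finset.range (n + 1)).erase i, (X + C (j : F)) = 0 := by
    apply IsFractionRing.injective F[X] (RatFunc F)
    rw [map_sum, map_zero]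
    have h2 : ∀ i ∈ Finset.range (n + 1), algebraMap F[X] (RatFunc F)
        (t i * ∏ j ∈ (Finset.range (n + 1)).erase i, (X + C (j : F))) =
        s i * algebraMap F[X] (RatFunc F) (∏ j ∈ Finset.range (n + 1), (X + C (j : F))) := by
      intro i hi
      rw [map_mul, hts, mul_assoc, ← map_mul,
        Finset.mul_prod_erase _ (fun j : ℕ => X + C (j : F)) hi]
    rw [Finset.sum_congr rfl h2, ← Finset.sum_mul, hs, zero_mul]
  have h3 := congrArg (eval (-(n : F))) h1
  rw [eval_finsetSum, Finset.sum_range_succ, eval_zero, Finset.sum_eq_zero, zero_add, eval_mul,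
    mul_eq_zero] at h3
  · refine h3.resolve_right ?_
    rw [eval_prod]
    refine Finset.prod_ne_zero_iff.2 fun j hj => ?_
    rw [eval_add, eval_X, eval_C, neg_add_eq_sub, sub_ne_zero]
    exact fun h => Finset.ne_of_mem_erase hj (Nat.cast_injective h)
  · intro i hi
    rw [eval_mul, eval_prod, Finset.prod_eq_zero (i := n), mul_zero]
    · rw [Finset.mem_erase, Finset.mem_range]
      exact ⟨(Finset.mem_range.1 hi).ne', n.lt_succ_self⟩
    · simp

theorem coeff_tau_sub_one_one : (tau F - 1 : Op F).coeff 1 = 1 := by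
  rw [coeff_sub, SkewPolynomial.coeff_X_one, SkewPolynomial.coeff_one, if_neg zero_ne_one, sub_zero]

theorem lcIdeal_tau_sub_one : lcIdeal (tau F - 1 : Op F) = ⊤ := by
  have hord : ord (tau F - 1 : Op F) = 1 := by
    refine ord_eq (by rw [coeff_tau_sub_one_one]; exact one_ne_zero) fun i hi => ?_
    rw [coeff_sub, SkewPolynomial.coeff_X, SkewPolynomial.coeff_one, if_neg hi.ne,
      if_neg (by omega), sub_zero]
  rw [Ideal.eq_top_iff_one]
  refine Ideal.subset_span ⟨1, one_ne_zero, fun i => ?_, 1, ?_, ?_⟩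
  · rw [one_mul, coeff_sub, SkewPolynomial.coeff_X, SkewPolynomial.coeff_one]
    exact ⟨(if 1 = i then 1 else 0) - (if 0 = i then 1 else 0), by split_ifs <;> simp⟩
  · rw [one_mul, hord, coeff_tau_sub_one_one, map_one]
  · simp

/-- The operator `x`. -/
abbrev opX (F : Type*) [Field F] : Op F :=
  SkewPolynomial.monomial 0 (algebraMap F[X] (RatFunc F) X)

/-- The coefficients of `A (τ - 1) x` are `s_i (x + i)`, where the coefficients `s_i` of `A (τ - 1)`
sum to zero. A pole of `s_n` at `-n` could not be cancelled by the other terms, so the leading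
coefficient vanishes at `-n`, which after the shift by `n` is divisibility by `x`. -/
theorem lcIdeal_tau_sub_one_mul_le [CharZero F] :
    lcIdeal ((tau F - 1) * opX F) ≤ Ideal.span {(X : F[X])} := by
  refine Ideal.span_le.2 ?_
  rintro _ ⟨A, -, hP, a, ha, rfl⟩
  rw [← mul_assoc] at hP ha ⊢
  set n := ord (A * (tau F - 1) * opX F) with hn
  rw [SetLike.mem_coe, Ideal.mem_span_singleton, X_dvd_iff, coeff_zero_eq_eval_zero, eval_comp]
  choose t ht using hP
  have hx (i : ℕ) : (shift F ^ i) (algebraMap F[X] (RatFunc F) X) =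
      algebraMap F[X] (RatFunc F) (X + C (i : F)) := by
    rw [shift_pow_algebraMap, taylor_X]
  have hts (i : ℕ) : algebraMap F[X] (RatFunc F) (t i) = (A * (tau F - 1)).coeff i *
      algebraMap F[X] (RatFunc F) (X + C (i : F)) := by
    rw [← ht, coeff_mul_monomial_zero, hx]
  have hat : a = t n := IsFractionRing.injective F[X] (RatFunc F) (ha.symm.trans (ht n))
  have := eval_neg_eq_zero_of_sum_eq_zero (n := n) t _ hts
    (sum_coeff_mul_tau_sub_one A fun i hi => by
      have h0 := coeff_mul_monomial_zero (A * (tau F - 1)) (algebraMap F[X] (RatFunc F) X) i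
      rw [coeff_eq_zero_of_ord_lt hi, hx] at h0
      refine (mul_eq_zero.1 h0.symm).resolve_right ?_
      exact algebraMap_ne_zero (X_add_C_ne_zero (i : F)))
  simpa [hat] using this

/-- Right multiplication by the unit `x` induces an isomorphism between quotient modules. -/
theorem nonempty_quotientModule_equiv_mul_opX (L : Op F) :
    Nonempty (QuotientModule L ≃ₗ[Op F] QuotientModule (L * opX F)) := by
  have hx : algebraMap F[X] (RatFunc F) X ≠ 0 := algebraMap_ne_zero X_ne_zero
  have hmul (r s : RatFunc F) (h : r * s = 1) :
      (SkewPolynomial.monomial 0 r * SkewPolynomial.monomial 0 s : Op F) = 1 := by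
    rw [SkewPolynomial.monomial_mul_monomial, Function.iterate_zero, id, h, add_zero,
      SkewPolynomial.monomial_zero_one]
  let f : Op F ≃ₗ[Op F] Op F := LinearEquiv.ofLinearMap
    (LinearMap.toSpanSingleton (Op F) (Op F) (opX F))
    (LinearMap.toSpanSingleton (Op F) (Op F)
      (SkewPolynomial.monomial 0 (algebraMap F[X] (RatFunc F) X)⁻¹))
    (by
      ext
      simp only [LinearMap.comp_apply, LinearMap.toSpanSingleton_apply, smul_eq_mul, one_mul,
        hmul _ _ (inv_mul_cancel₀ hx), LinearMap.id_apply])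
    (by
      ext
      simp only [LinearMap.comp_apply, LinearMap.toSpanSingleton_apply, smul_eq_mul, one_mul,
        hmul _ _ (mul_inv_cancel₀ hx), LinearMap.id_apply])
  refine ⟨Submodule.Quotient.equiv _ _ f ?_⟩
  rw [Submodule.map_span, Set.image_singleton]
  rfl

/-- Shifting preserves degrees, so `f(x + 1) / f(x)` has degree zero as a rational function. -/
theorem natDegree_eq_zero_of_shiftEquivalent_one {q : F[X]} (hq : q ≠ 0)
    (h : ShiftEquivalent 1 (algebraMap F[X] (RatFunc F) q)) : q.natDegree = 0 := by
  obtain ⟨f, hf, h⟩ := h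
  obtain ⟨a, b, hb, rfl⟩ := IsFractionRing.div_surjective (A := F[X]) f
  have hb0 : b ≠ 0 := nonZeroDivisors.ne_zero hb
  have ha0 : a ≠ 0 := by
    rintro rfl
    simp at hf
  have ht {r : F[X]} (hr : r ≠ 0) : taylor 1 r ≠ 0 := by simpa using hr
  have key : taylor 1 b * a = taylor 1 a * b * q := by
    apply IsFractionRing.injective F[X] (RatFunc F)
    rw [map_div₀, shift_algebraMap, shift_algebraMap] at h
    have h1 := algebraMap_ne_zero hq
    have h2 := algebraMap_ne_zero hb0
    have h3 := algebraMap_ne_zero ha0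
    have h4 := algebraMap_ne_zero (ht hb0)
    field_simp at h
    simp only [map_mul]
    linear_combination h
  have := congrArg natDegree key
  rw [natDegree_mul (ht hb0) ha0, natDegree_mul (mul_ne_zero (ht ha0) hb0) hq,
    natDegree_mul (ht ha0) hb0, natDegree_taylor, natDegree_taylor] at this
  omega

theorem exists_not_shiftEquivalent (F : Type*) [Field F] [CharZero F] :
    ∃ L₁ L₂ : Op F, L₁ ≠ 0 ∧ L₂ ≠ 0 ∧
      Nonempty (QuotientModule L₁ ≃ₗ[Op F] QuotientModule L₂) ∧
      ¬ ShiftEquivalent (algebraMap F[X] (RatFunc F) (lcInf L₁))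
        (algebraMap F[X] (RatFunc F) (lcInf L₂)) ∧
      ¬ SameTrueSingularitiesUpToShifts L₁ L₂ := by
  classical
  have h₁ : (tau F - 1 : Op F) ≠ 0 := fun h => by
    have := coeff_tau_sub_one_one (F := F)
    rw [h, SkewPolynomial.coeff_zero] at this
    exact zero_ne_one this
  have h₂ : ((tau F - 1) * opX F : Op F) ≠ 0 := fun h => by
    have := coeff_mul_monomial_zero (tau F - 1) (algebraMap F[X] (RatFunc F) X) 1
    rw [h, SkewPolynomial.coeff_zero, coeff_tau_sub_one_one, shift_pow_algebraMap, taylor_X] at this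
    exact algebraMap_ne_zero (X_add_C_ne_zero ((1 : ℕ) : F))
      (by rw [← one_mul (algebraMap _ _ _), ← this])
  have hlc₁ : lcInf (tau F - 1 : Op F) = 1 := by
    rw [lcInf, normalize_eq_one, ← Ideal.span_singleton_eq_top, Ideal.span_singleton_generator,
      lcIdeal_tau_sub_one]
  have hX : X ∣ lcInf ((tau F - 1) * opX F : Op F) := by
    refine dvd_trans ?_ (lcInf_associated _).symm.dvd
    rw [← Ideal.mem_span_singleton]
    exact lcIdeal_tau_sub_one_mul_le (Submodule.IsPrincipal.generator_mem _)
  have hdeg : (lcInf ((tau F - 1) * opX F : Op F)).natDegree ≠ 0 := by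
    have := natDegree_le_of_dvd hX (lcInf_ne_zero h₂)
    rw [natDegree_X] at this
    omega
  -- Shift equivalence fails by degree; the matching fails because `τ - 1` has no true singularities
  -- while `(τ - 1) x` has at least one.
  refine ⟨_, _, h₁, h₂, nonempty_quotientModule_equiv_mul_opX _, fun h => ?_, fun h => ?_⟩
  · rw [hlc₁, map_one] at h
    exact hdeg (natDegree_eq_zero_of_shiftEquivalent_one (lcInf_ne_zero h₂) h)
  · have h0 : trueSingularities (tau F - 1 : Op F) = 0 := by
      rw [trueSingularities, hlc₁, UniqueFactorizationMonoid.normalizedFactors_one]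
    rw [SameTrueSingularitiesUpToShifts, h0, Multiset.rel_zero_left] at h
    have := prod_trueSingularities h₂
    rw [h, Multiset.prod_zero] at this
    rw [← this] at hdeg
    exact hdeg natDegree_one

end CharZero

end RecurrenceOperator

end

theorem mainTheorem2 :
    (∀ (p : ℕ) (F : Type*) [Fact p.Prime] [Field F] [CharP F p]
      (L₁ L₂ : RecurrenceOperator.Op F), L₁ ≠ 0 → L₂ ≠ 0 →
      Nonempty (RecurrenceOperator.QuotientModule L₁ ≃ₗ[RecurrenceOperator.Op F]
        RecurrenceOperator.QuotientModule L₂) →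
      RecurrenceOperator.ShiftEquivalent
        (algebraMap (Polynomial F) (RatFunc F) (RecurrenceOperator.lcInf L₁))
        (algebraMap (Polynomial F) (RatFunc F) (RecurrenceOperator.lcInf L₂)) ∧
      RecurrenceOperator.SameTrueSingularitiesUpToShifts L₁ L₂) ∧
    (∀ (F : Type*) [Field F] [CharZero F],
      ∃ L₁ L₂ : RecurrenceOperator.Op F, L₁ ≠ 0 ∧ L₂ ≠ 0 ∧
        Nonempty (RecurrenceOperator.QuotientModule L₁ ≃ₗ[RecurrenceOperator.Op F]
          RecurrenceOperator.QuotientModule L₂) ∧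
        ¬ RecurrenceOperator.ShiftEquivalent
          (algebraMap (Polynomial F) (RatFunc F) (RecurrenceOperator.lcInf L₁))
          (algebraMap (Polynomial F) (RatFunc F) (RecurrenceOperator.lcInf L₂)) ∧
        ¬ RecurrenceOperator.SameTrueSingularitiesUpToShifts L₁ L₂) := by
  refine ⟨?_, ?_⟩
  · rintro p F _ _ _ L₁ L₂ h₁ h₂ ⟨φ⟩
    exact RecurrenceOperator.shiftEquivalent_and_sameTrueSingularities p h₁ h₂ φ
  · intro F _ _
    exact RecurrenceOperator.exists_not_shiftEquivalent F
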